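/- **Theorem 5.12.** A *modal Riesz space* is a Riesz space $A$ (a real vector space with a compatible lattice order) together with an element $u\ge 0$ and a linear map $\Diamond:A\to A$ such that $\Diamond(a)\ge 0$ for all $a\ge 0$ and $\Diamond(u)\le u$. Homomorphisms are the linear maps preserving $\sqcup$, $\sqcap$, $u$ and $\Diamond$. It is *unital* if for every $a\in A$ there is $n\in\mathbb N$ with $|a|\le nu$. An element $a$ is *infinitely small* if there is $b\in A$ with $n|a|\le |b|$ for all $n\in\mathbb N$, and $A$ is *Archimedean* if $0$ is its only infinitely small element. $A$ is *uniformly complete* if for every $v\ge 0$ in $A$ and every sequence $(a_n)$ in $A$ such that for all real $\varepsilon>0$ one has $|a_i-a_j|\le\varepsilon v$ for all sufficiently large $i,j$, there is $b\in A$ such that for all $\varepsilon>0$ one has $|b-a_n|\le\varepsilon v$ for all sufficiently large $n$. Let $\mathbb I$ be the modal Riesz space of formulas $\phi::=0\mid 1\mid r\phi\mid\phi+\phi\mid\phi\sqcup\phi\mid\phi\sqcap\phi\mid\Diamond\phi$ ($r\in\mathbb R$) modulo provable equality in equational logic from the axioms of modal Riesz spaces, with $1$ interpreting $u$, and let $\mathbb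 I_a$ be the quotient of $\mathbb I$ that identifies $x$ and $y$ whenever $|x-y|$ is infinitely small. Then $\mathbb I_a$ is the initial Archimedean unital modal Riesz space (that is, it is Archimedean and unital, and it has exactly one homomorphism to every Archimedean unital modal Riesz space), and $\mathbb I_a$ is not uniformly complete. -/

import Mathlib

namespace RieszModal

/-! ### Riesz spaces and modal Riesz spaces

A Riesz space is a real vector space `A` with a lattice order compatible with addition and with
multiplication by nonnegative scalars:
`[AddCommGroup A] [Module ℝ A] [Lattice A] [IsOrderedAddMonoid A] [PosSMulMono ℝ A]`.
The absolute value `|a| = a ⊔ -a` is Mathlib's; it equals `(a ⊔ 0) + (-a ⊔ 0)`. -/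

section RieszSpaces

variable (A : Type*) [AddCommGroup A] [Lattice A]

variable {A} in
/-- `a` is infinitely small if for some `b` one has `n |a| ≤ |b|` for all natural numbers `n`. -/
def InfinitelySmall (a : A) : Prop := ∃ b : A, ∀ n : ℕ, n • |a| ≤ |b|

/-- A Riesz space is Archimedean if `0` is its only infinitely small element. -/
def IsArchimedean : Prop := ∀ a : A, InfinitelySmall a → a = 0

variable {A} in
/-- A strong unit is a positive element some multiple of which dominates any given `|a|`. -/
def IsStrongUnit (u : A) : Prop := 0 ≤ u ∧ ∀ a : A, ∃ n : ℕ, |a| ≤ n • u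

variable [Module ℝ A]

variable {A} in
/-- The sequence `a` converges `u`-uniformly to `b`. -/
def ConvergesUniformly (u : A) (a : ℕ → A) (b : A) : Prop :=
  ∀ ε : ℝ, 0 < ε → ∃ N : ℕ, ∀ n, N < n → |b - a n| ≤ ε • u

variable {A} in
/-- The sequence `a` is `u`-uniformly Cauchy. -/
def IsUniformCauchy (u : A) (a : ℕ → A) : Prop :=
  ∀ ε : ℝ, 0 < ε → ∃ N : ℕ, ∀ i j, N < i → N < j → |a i - a j| ≤ ε • u

/-- `A` is uniformly complete if, for every `u ≥ 0`, every `u`-uniformly Cauchy sequence converges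
`u`-uniformly to some element of `A`. -/
def IsUniformlyComplete : Prop :=
  ∀ u : A, 0 ≤ u → ∀ a : ℕ → A, IsUniformCauchy u a → ∃ b : A, ConvergesUniformly u a b

end RieszSpaces

/-- The modal structure on a Riesz space: a designated positive element `unit` and a linear,
positive and `unit`-decreasing operation `dia`. -/
class ModalStructure (A : Type*) [AddCommGroup A] [Module ℝ A] [Lattice A] where
  unit : A
  unit_nonneg : 0 ≤ unit
  dia : A →ₗ[ℝ] A
  dia_nonneg : ∀ a : A, 0 ≤ dia (a ⊔ 0)
  dia_unit_le : dia unit ≤ unit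

/-- Homomorphisms of modal Riesz spaces: maps preserving all the operations. -/
structure ModalHom (A B : Type*)
    [AddCommGroup A] [Module ℝ A] [Lattice A] [ModalStructure A]
    [AddCommGroup B] [Module ℝ B] [Lattice B] [ModalStructure B] extends A →ₗ[ℝ] B where
  map_sup' : ∀ a b : A, toFun (a ⊔ b) = toFun a ⊔ toFun b
  map_inf' : ∀ a b : A, toFun (a ⊓ b) = toFun a ⊓ toFun b
  map_unit' : toFun ModalStructure.unit = ModalStructure.unit
  map_dia' : ∀ a : A, toFun (ModalStructure.dia a) = ModalStructure.dia (toFun a)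

/-! ### Formulas and provable equality -/

/-- Formulas of Riesz modal logic, that is, terms without variables in the signature of modal
Riesz spaces. -/
inductive Form : Type
  | zero : Form
  | one : Form
  | smul : ℝ → Form → Form
  | add : Form → Form → Form
  | sup : Form → Form → Form
  | inf : Form → Form → Form
  | dia : Form → Form

open Form in
/-- Provable equality in equational logic from the axioms of modal Riesz spaces. As usual `-φ`
abbreviates `(-1)φ`, and `φ ≤ ψ` abbreviates `φ ⊓ ψ = φ`. -/
inductive Provable : Form → Form → Prop
  -- rules of equational logic
  | refl (x) : Provable x x
  | symm {x y} : Provable x y → Provable y x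
  | trans {x y z} : Provable x y → Provable y z → Provable x z
  | congr_smul (r : ℝ) {x x'} : Provable x x' → Provable (smul r x) (smul r x')
  | congr_add {x x' y y'} : Provable x x' → Provable y y' → Provable (add x y) (add x' y')
  | congr_sup {x x' y y'} : Provable x x' → Provable y y' → Provable (sup x y) (sup x' y')
  | congr_inf {x x' y y'} : Provable x x' → Provable y y' → Provable (inf x y) (inf x' y')
  | congr_dia {x x'} : Provable x x' → Provable (dia x) (dia x')
  -- real vector space
  | add_assoc (x y z) : Provable (add x (add y z)) (add (add x y) z)
  | add_comm (x y) : Provable (add x y) (add y x)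
  | add_zero (x) : Provable (add x zero) x
  | add_neg (x) : Provable (add x (smul (-1) x)) zero
  | smul_smul (r s : ℝ) (x) : Provable (smul r (smul s x)) (smul (r * s) x)
  | one_smul (x) : Provable (smul 1 x) x
  | smul_add (r : ℝ) (x y) : Provable (smul r (add x y)) (add (smul r x) (smul r y))
  | add_smul (r s : ℝ) (x) : Provable (smul (r + s) x) (add (smul r x) (smul s x))
  -- lattice
  | sup_assoc (x y z) : Provable (sup x (sup y z)) (sup (sup x y) z)
  | inf_assoc (x y z) : Provable (inf x (inf y z)) (inf (inf x y) z)
  | sup_comm (x y) : Provable (sup x y) (sup y x)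
  | inf_comm (x y) : Provable (inf x y) (inf y x)
  | sup_inf_self (x y) : Provable (sup x (inf x y)) x
  | inf_sup_self (x y) : Provable (inf x (sup x y)) x
  | sup_idem (x) : Provable (sup x x) x
  | inf_idem (x) : Provable (inf x x) x
  -- compatibility: `(x ⊓ y) + z ≤ y + z`, and `r (x ⊓ y) ≤ r y` for `r ≥ 0`
  | add_compat (x y z) :
      Provable (inf (add (inf x y) z) (add y z)) (add (inf x y) z)
  | smul_compat (r : ℝ) (x y) : 0 ≤ r →
      Provable (inf (smul r (inf x y)) (smul r y)) (smul r (inf x y))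
  -- positive element: `0 ≤ 1`
  | one_nonneg : Provable (inf zero one) zero
  -- modality: linear, `0 ≤ ◇(x ⊔ 0)`, and `◇1 ≤ 1`
  | dia_linear (r s : ℝ) (x y) : Provable (dia (add (smul r x) (smul s y)))
      (add (smul r (dia x)) (smul s (dia y)))
  | dia_nonneg (x) : Provable (inf zero (dia (sup x zero))) zero
  | dia_one_le : Provable (inf (dia one) one) (dia one)

/-- Provable equality as an equivalence relation. -/
def provableSetoid : Setoid Form := ⟨Provable, ⟨.refl, .symm, .trans⟩⟩

/-! ### The term algebra `𝕀` of formulas modulo provable equality -/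

/-- Formulas modulo provable equality. -/
def TermAlg : Type := Quotient provableSetoid

namespace TermAlg

/-- The class of a formula. -/
def mk (φ : Form) : TermAlg := Quotient.mk provableSetoid φ

theorem sound {φ ψ : Form} (h : Provable φ ψ) : mk φ = mk ψ := Quotient.sound h

theorem exact {φ ψ : Form} (h : mk φ = mk ψ) : Provable φ ψ := Quotient.exact h

theorem ind {p : TermAlg → Prop} (h : ∀ φ, p (mk φ)) (x : TermAlg) : p x := Quotient.ind h x

instance : Zero TermAlg := ⟨mk .zero⟩
instance : Add TermAlg := ⟨Quotient.map₂ .add fun _ _ h _ _ h' => .congr_add h h'⟩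
instance : SMul ℝ TermAlg := ⟨fun r => Quotient.map (.smul r) fun _ _ h => .congr_smul r h⟩
instance (priority := low) : Neg TermAlg := ⟨fun x => (-1 : ℝ) • x⟩
instance (priority := low) : Max TermAlg := ⟨Quotient.map₂ .sup fun _ _ h _ _ h' => .congr_sup h h'⟩
instance (priority := low) : Min TermAlg := ⟨Quotient.map₂ .inf fun _ _ h _ _ h' => .congr_inf h h'⟩

theorem mk_zero : mk .zero = 0 := rfl
theorem mk_add (φ ψ : Form) : mk (.add φ ψ) = mk φ + mk ψ := rfl
theorem mk_smul (r : ℝ) (φ : Form) : mk (.smul r φ) = r • mk φ := rfl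
theorem mk_sup (φ ψ : Form) : mk (.sup φ ψ) = mk φ ⊔ mk ψ := rfl
theorem mk_inf (φ ψ : Form) : mk (.inf φ ψ) = mk φ ⊓ mk ψ := rfl

protected theorem add_comm (x y : TermAlg) : x + y = y + x := by
  induction x using ind
  induction y using ind
  exact sound (.add_comm _ _)

protected theorem add_zero (x : TermAlg) : x + 0 = x := by
  induction x using ind
  exact sound (.add_zero _)

protected theorem add_neg (x : TermAlg) : x + -x = 0 := by
  induction x using ind
  exact sound (.add_neg _)

instance : AddCommGroup TermAlg where
  add_assoc x y z := by
    induction x using ind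
    induction y using ind
    induction z using ind
    exact (sound (.add_assoc _ _ _)).symm
  zero_add x := (TermAlg.add_comm 0 x).trans (TermAlg.add_zero x)
  add_zero := TermAlg.add_zero
  add_comm := TermAlg.add_comm
  neg_add_cancel x := (TermAlg.add_comm (-x) x).trans (TermAlg.add_neg x)
  nsmul := nsmulRec
  zsmul := zsmulRec

protected theorem smul_add (r : ℝ) (x y : TermAlg) : r • (x + y) = r • x + r • y := by
  induction x using ind
  induction y using ind
  exact sound (.smul_add _ _ _)

protected theorem add_smul (r s : ℝ) (x : TermAlg) : (r + s) • x = r • x + s • x := by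
  induction x using ind
  exact sound (.add_smul _ _ _)

instance : Module ℝ TermAlg where
  one_smul x := by
    induction x using ind
    exact sound (.one_smul _)
  mul_smul r s x := by
    induction x using ind
    exact (sound (.smul_smul _ _ _)).symm
  smul_zero r := by
    have h := TermAlg.smul_add r 0 0
    rw [_root_.add_zero] at h
    exact left_eq_add.mp h
  smul_add := TermAlg.smul_add
  add_smul := TermAlg.add_smul
  zero_smul x := by
    have h := TermAlg.add_smul 0 0 x
    rw [_root_.add_zero] at h
    exact left_eq_add.mp h

protected theorem inf_comm (x y : TermAlg) : x ⊓ y = y ⊓ x := by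
  induction x using ind
  induction y using ind
  exact sound (.inf_comm _ _)

protected theorem sup_comm (x y : TermAlg) : x ⊔ y = y ⊔ x := by
  induction x using ind
  induction y using ind
  exact sound (.sup_comm _ _)

protected theorem inf_assoc (x y z : TermAlg) : x ⊓ (y ⊓ z) = x ⊓ y ⊓ z := by
  induction x using ind
  induction y using ind
  induction z using ind
  exact sound (.inf_assoc _ _ _)

protected theorem sup_assoc (x y z : TermAlg) : x ⊔ (y ⊔ z) = x ⊔ y ⊔ z := by
  induction x using ind
  induction y using ind
  induction z using ind
  exact sound (.sup_assoc _ _ _)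

protected theorem inf_idem (x : TermAlg) : x ⊓ x = x := by
  induction x using ind
  exact sound (.inf_idem _)

protected theorem inf_sup_self (x y : TermAlg) : x ⊓ (x ⊔ y) = x := by
  induction x using ind
  induction y using ind
  exact sound (.inf_sup_self _ _)

protected theorem sup_inf_self (x y : TermAlg) : x ⊔ (x ⊓ y) = x := by
  induction x using ind
  induction y using ind
  exact sound (.sup_inf_self _ _)

protected theorem sup_of_inf {x y : TermAlg} (h : x ⊓ y = x) : x ⊔ y = y := by
  rw [← h, TermAlg.sup_comm, TermAlg.inf_comm, TermAlg.sup_inf_self]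

protected theorem inf_of_sup {x y : TermAlg} (h : x ⊔ y = y) : x ⊓ y = x := by
  rw [← h, TermAlg.inf_sup_self]

/-- The order is the one induced by the lattice operations: `x ≤ y` means `x ⊓ y = x`. -/
instance : Lattice TermAlg where
  le x y := x ⊓ y = x
  le_refl := TermAlg.inf_idem
  le_trans x y z h h' := by
    change x ⊓ y = x at h
    change y ⊓ z = y at h'
    rw [← h, ← TermAlg.inf_assoc, h']
  le_antisymm x y h h' := by
    change x ⊓ y = x at h
    change y ⊓ x = y at h'
    rw [← h, TermAlg.inf_comm, h']
  sup := max
  inf := min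
  le_sup_left := TermAlg.inf_sup_self
  le_sup_right x y := by
    rw [TermAlg.sup_comm, TermAlg.inf_sup_self]
  sup_le x y z h h' := TermAlg.inf_of_sup (by
    change x ⊓ z = x at h
    change y ⊓ z = y at h'
    rw [← TermAlg.sup_assoc, TermAlg.sup_of_inf h', TermAlg.sup_of_inf h])
  inf_le_left x y := by
    rw [TermAlg.inf_comm, TermAlg.inf_assoc, TermAlg.inf_idem]
  inf_le_right x y := by
    rw [← TermAlg.inf_assoc, TermAlg.inf_idem]
  le_inf x y z h h' := by
    change x ⊓ y = x at h
    change x ⊓ z = x at h'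
    rw [TermAlg.inf_assoc, h, h']

theorem le_def {x y : TermAlg} : x ≤ y ↔ x ⊓ y = x := Iff.rfl

instance : IsOrderedAddMonoid TermAlg where
  add_le_add_left := by
    intro x y h z
    rw [le_def] at h
    rw [← h]
    clear h
    induction x using ind
    induction y using ind
    induction z using ind
    exact sound (.add_compat _ _ _)

instance : PosSMulMono ℝ TermAlg where
  smul_le_smul_of_nonneg_left := by
    intro r hr x y h
    rw [le_def] at h
    rw [← h]
    clear h
    induction x using ind
    induction y using ind
    exact sound (.smul_compat _ _ _ hr)

/-- The modality on formulas modulo provable equality. -/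
def diaFun : TermAlg → TermAlg := Quotient.map .dia fun _ _ h => .congr_dia h

theorem diaFun_linear (r s : ℝ) (x y : TermAlg) :
    diaFun (r • x + s • y) = r • diaFun x + s • diaFun y := by
  induction x using ind
  induction y using ind
  exact sound (.dia_linear _ _ _ _)

instance : ModalStructure TermAlg where
  unit := mk .one
  unit_nonneg := sound .one_nonneg
  dia :=
    { toFun := diaFun
      map_add' := fun x y => by simpa using diaFun_linear 1 1 x y
      map_smul' := fun r x => by simpa using diaFun_linear r 0 x 0 }
  dia_nonneg := by
    intro x
    induction x using ind
    exact sound (.dia_nonneg _)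
  dia_unit_le := sound .dia_one_le

end TermAlg

/-! ### The quotient of a modal Riesz space by its infinitely small elements -/

section Quotient

variable {A : Type*} [AddCommGroup A] [Lattice A] [IsOrderedAddMonoid A]

theorem InfinitelySmall.of_abs_le {a b : A} (hb : InfinitelySmall b) (h : |a| ≤ |b|) :
    InfinitelySmall a :=
  hb.imp fun _ hc n => (nsmul_le_nsmul_right h n).trans (hc n)

theorem InfinitelySmall.add {a b : A} (ha : InfinitelySmall a) (hb : InfinitelySmall b) :
    InfinitelySmall (a + b) := by
  obtain ⟨c, hc⟩ := ha
  obtain ⟨d, hd⟩ := hb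
  refine ⟨|c| + |d|, fun n => ?_⟩
  rw [abs_of_nonneg (add_nonneg (abs_nonneg c) (abs_nonneg d))]
  calc n • |a + b| ≤ n • (|a| + |b|) := nsmul_le_nsmul_right (abs_add_le a b) n
    _ = n • |a| + n • |b| := nsmul_add _ _ _
    _ ≤ |c| + |d| := add_le_add (hc n) (hd n)

variable [Module ℝ A]

theorem dia_mono [ModalStructure A] {a b : A} (h : a ≤ b) :
    ModalStructure.dia a ≤ ModalStructure.dia b := by
  have h' := ModalStructure.dia_nonneg (b - a)
  rw [sup_eq_left.mpr (sub_nonneg.mpr h), map_sub] at h'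
  exact sub_nonneg.mp h'

theorem abs_dia_le [ModalStructure A] (a : A) : |ModalStructure.dia a| ≤ ModalStructure.dia |a| := by
  refine sup_le (dia_mono (le_abs_self a)) ?_
  rw [← map_neg]
  exact dia_mono (neg_le_abs a)

theorem InfinitelySmall.dia [ModalStructure A] {a : A} (h : InfinitelySmall a) :
    InfinitelySmall (ModalStructure.dia a) := by
  obtain ⟨b, hb⟩ := h
  refine ⟨ModalStructure.dia |b|, fun n => ?_⟩
  calc n • |ModalStructure.dia a| ≤ n • ModalStructure.dia |a| :=
        nsmul_le_nsmul_right (abs_dia_le a) n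
    _ = ModalStructure.dia (n • |a|) := (map_nsmul _ _ _).symm
    _ ≤ ModalStructure.dia |b| := dia_mono (hb n)
    _ ≤ |(ModalStructure.dia |b| : A)| := le_abs_self _

variable [PosSMulMono ℝ A]

theorem abs_smul_le (r : ℝ) (a : A) : |r • a| ≤ |r| • |a| := by
  have h0 : (0 : A) ≤ |a| := abs_nonneg a
  rcases le_total 0 r with hr | hr
  · rw [abs_of_nonneg hr]
    refine sup_le (smul_le_smul_of_nonneg_left (le_abs_self a) hr) ?_
    rw [← smul_neg]
    exact smul_le_smul_of_nonneg_left (neg_le_abs a) hr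
  · rw [abs_of_nonpos hr]
    have hr' : 0 ≤ -r := neg_nonneg.mpr hr
    refine sup_le ?_ ?_
    · rw [← neg_smul_neg]
      exact smul_le_smul_of_nonneg_left (neg_le_abs a) hr'
    · rw [← neg_smul]
      exact smul_le_smul_of_nonneg_left (le_abs_self a) hr'

theorem InfinitelySmall.smul (r : ℝ) {a : A} (ha : InfinitelySmall a) :
    InfinitelySmall (r • a) := by
  obtain ⟨c, hc⟩ := ha
  refine ⟨|r| • |c|, fun n => ?_⟩
  have h : (0 : A) ≤ |r| • |c| := smul_nonneg (abs_nonneg r) (abs_nonneg c)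
  rw [abs_of_nonneg h]
  calc n • |r • a| ≤ n • (|r| • |a|) := nsmul_le_nsmul_right (abs_smul_le r a) n
    _ = |r| • (n • |a|) := (smul_comm |r| n |a|).symm
    _ ≤ |r| • |c| := smul_le_smul_of_nonneg_left (hc n) (abs_nonneg r)

variable (A) in
/-- The ideal of infinitely small elements. -/
def infinitesimals : Submodule ℝ A where
  carrier := {a | InfinitelySmall a}
  add_mem' := InfinitelySmall.add
  zero_mem' := ⟨0, fun n => by simp⟩
  smul_mem' := fun r _ h => InfinitelySmall.smul r h

variable (A) in
/-- The quotient of `A` by its infinitely small elements, identifying `x` and `y` when `x - y`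
(equivalently `|x - y|`) is infinitely small. The vector space structure is that of a quotient
module; the lattice operations and the modality are those induced from `A`. -/
abbrev ArchQuotient : Type _ := A ⧸ infinitesimals A

namespace ArchQuotient

/-- The class of an element. -/
def mk (a : A) : ArchQuotient A := (infinitesimals A).mkQ a

theorem mk_eq {a b : A} : mk a = mk b ↔ InfinitelySmall (a - b) :=
  Submodule.Quotient.eq (infinitesimals A)

theorem ind {p : ArchQuotient A → Prop} (h : ∀ a, p (mk a)) (x : ArchQuotient A) : p x :=
  Submodule.Quotient.induction_on _ x h

theorem quotientRel_iff {a b : A} :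
    (infinitesimals A).quotientRel a b ↔ InfinitelySmall (a - b) :=
  Submodule.quotientRel_def (infinitesimals A)

/-- A binary operation on `A` that is nonexpansive in each variable passes to the quotient. -/
def map₂ (f : A → A → A) (hl : ∀ a a' b, |f a b - f a' b| ≤ |a - a'|)
    (hr : ∀ a b b', |f a b - f a b'| ≤ |b - b'|) :
    ArchQuotient A → ArchQuotient A → ArchQuotient A :=
  Quotient.map₂ (sa := (infinitesimals A).quotientRel) (sb := (infinitesimals A).quotientRel)
    (sc := (infinitesimals A).quotientRel) f fun a a' h b b' h' => by
      replace h := quotientRel_iff.mp h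
      replace h' := quotientRel_iff.mp h'
      refine quotientRel_iff.mpr ?_
      rw [← sub_add_sub_cancel (f a b) (f a' b) (f a' b')]
      exact (h.of_abs_le (hl a a' b)).add (h'.of_abs_le (hr a' b b'))

theorem map₂_mk (f : A → A → A) (hl hr) (a b : A) : map₂ f hl hr (mk a) (mk b) = mk (f a b) :=
  rfl

instance (priority := low) : Max (ArchQuotient A) :=
  ⟨map₂ (fun a b => a ⊔ b) (fun a a' b => abs_sup_sub_sup_le_abs a a' b) fun a b b' => by
    rw [sup_comm a b, sup_comm a b']
    exact abs_sup_sub_sup_le_abs b b' a⟩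

instance (priority := low) : Min (ArchQuotient A) :=
  ⟨map₂ (fun a b => a ⊓ b) (fun a a' b => abs_inf_sub_inf_le_abs a a' b) fun a b b' => by
    rw [inf_comm a b, inf_comm a b']
    exact abs_inf_sub_inf_le_abs b b' a⟩

theorem mk_sup (a b : A) : mk (a ⊔ b) = mk a ⊔ mk b := rfl
theorem mk_inf (a b : A) : mk (a ⊓ b) = mk a ⊓ mk b := rfl
theorem mk_add (a b : A) : mk (a + b) = mk a + mk b := rfl
theorem mk_smul (r : ℝ) (a : A) : mk (r • a) = r • mk a := rfl

protected theorem inf_comm (x y : ArchQuotient A) : x ⊓ y = y ⊓ x := by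
  induction x using ind
  induction y using ind
  exact congrArg mk (_root_.inf_comm _ _)

protected theorem sup_comm (x y : ArchQuotient A) : x ⊔ y = y ⊔ x := by
  induction x using ind
  induction y using ind
  exact congrArg mk (_root_.sup_comm _ _)

protected theorem inf_assoc (x y z : ArchQuotient A) : x ⊓ (y ⊓ z) = x ⊓ y ⊓ z := by
  induction x using ind
  induction y using ind
  induction z using ind
  exact congrArg mk (_root_.inf_assoc _ _ _).symm

protected theorem sup_assoc (x y z : ArchQuotient A) : x ⊔ (y ⊔ z) = x ⊔ y ⊔ z := by
  induction x using ind
  induction y using ind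
  induction z using ind
  exact congrArg mk (_root_.sup_assoc _ _ _).symm

protected theorem inf_idem (x : ArchQuotient A) : x ⊓ x = x := by
  induction x using ind
  exact congrArg mk (_root_.inf_idem _)

protected theorem inf_sup_self (x y : ArchQuotient A) : x ⊓ (x ⊔ y) = x := by
  induction x using ind
  induction y using ind
  exact congrArg mk (_root_.inf_sup_self)

protected theorem sup_inf_self (x y : ArchQuotient A) : x ⊔ (x ⊓ y) = x := by
  induction x using ind
  induction y using ind
  exact congrArg mk (_root_.sup_inf_self)

protected theorem sup_of_inf {x y : ArchQuotient A} (h : x ⊓ y = x) : x ⊔ y = y := by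
  rw [← h, ArchQuotient.sup_comm, ArchQuotient.inf_comm, ArchQuotient.sup_inf_self]

protected theorem inf_of_sup {x y : ArchQuotient A} (h : x ⊔ y = y) : x ⊓ y = x := by
  rw [← h, ArchQuotient.inf_sup_self]

/-- The order is the one induced by the lattice operations: `x ≤ y` means `x ⊓ y = x`. -/
instance : Lattice (ArchQuotient A) where
  le x y := x ⊓ y = x
  le_refl := ArchQuotient.inf_idem
  le_trans x y z h h' := by
    change x ⊓ y = x at h
    change y ⊓ z = y at h'
    rw [← h, ← ArchQuotient.inf_assoc, h']
  le_antisymm x y h h' := by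
    change x ⊓ y = x at h
    change y ⊓ x = y at h'
    rw [← h, ArchQuotient.inf_comm, h']
  sup := max
  inf := min
  le_sup_left := ArchQuotient.inf_sup_self
  le_sup_right x y := by
    rw [ArchQuotient.sup_comm, ArchQuotient.inf_sup_self]
  sup_le x y z h h' := ArchQuotient.inf_of_sup (by
    change x ⊓ z = x at h
    change y ⊓ z = y at h'
    rw [← ArchQuotient.sup_assoc, ArchQuotient.sup_of_inf h', ArchQuotient.sup_of_inf h])
  inf_le_left x y := by
    rw [ArchQuotient.inf_comm, ArchQuotient.inf_assoc, ArchQuotient.inf_idem]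
  inf_le_right x y := by
    rw [← ArchQuotient.inf_assoc, ArchQuotient.inf_idem]
  le_inf x y z h h' := by
    change x ⊓ y = x at h
    change x ⊓ z = x at h'
    rw [ArchQuotient.inf_assoc, h, h']

theorem le_def {x y : ArchQuotient A} : x ≤ y ↔ x ⊓ y = x := Iff.rfl

theorem mk_le_mk {a b : A} (h : a ≤ b) : mk a ≤ mk b := by
  rw [le_def, ← mk_inf, inf_eq_left.mpr h]

theorem exists_le_of_le {x y : ArchQuotient A} (h : x ≤ y) :
    ∃ a b : A, a ≤ b ∧ mk a = x ∧ mk b = y := by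
  induction x using ind with | _ a
  induction y using ind with | _ b
  rw [le_def, ← mk_inf] at h
  exact ⟨a ⊓ b, b, inf_le_right, h, rfl⟩

instance : IsOrderedAddMonoid (ArchQuotient A) where
  add_le_add_left := by
    intro x y h z
    obtain ⟨a, b, hab, rfl, rfl⟩ := exists_le_of_le h
    induction z using ind with | _ c
    rw [← mk_add, ← mk_add]
    exact mk_le_mk (add_le_add_left hab c)

instance : PosSMulMono ℝ (ArchQuotient A) where
  smul_le_smul_of_nonneg_left := by
    intro r hr x y h
    obtain ⟨a, b, hab, rfl, rfl⟩ := exists_le_of_le h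
    rw [← mk_smul, ← mk_smul]
    exact mk_le_mk (smul_le_smul_of_nonneg_left hab hr)

/-- The modal structure on the quotient, induced from that of `A`. -/
instance [ModalStructure A] : ModalStructure (ArchQuotient A) where
  unit := mk ModalStructure.unit
  unit_nonneg := mk_le_mk ModalStructure.unit_nonneg
  dia := (infinitesimals A).mapQ (infinitesimals A) ModalStructure.dia
    fun _ h => InfinitelySmall.dia h
  dia_nonneg := by
    intro x
    induction x using ind with | _ a
    exact mk_le_mk (ModalStructure.dia_nonneg a)
  dia_unit_le := mk_le_mk ModalStructure.dia_unit_le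

end ArchQuotient

end Quotient

/-- The modal Riesz space `𝕀_a`: formulas modulo provable equality, modulo infinitely small
elements. -/
abbrev InitialArch : Type := ArchQuotient TermAlg

end RieszModal

namespace RieszModal

open ModalStructure

/-! ### Infinitely small elements in the presence of a strong unit. -/

section General

/-! Initiality. Evaluation of closed formulas respects provable equality (`Provable.eval_eq`), and a
homomorphism sends infinitely small elements to infinitely small ones, so into an Archimedean target
it factors through `ArchQuotient`. Every element of `𝕀_a` is the class of a formula, whose image is
forced by structural recursion; this gives uniqueness.

`𝕀_a` is Archimedean because `1` is a strong unit of `𝕀`, by induction on formulas. All infinitely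
small elements then lie below the one element `u`, so inequalities in the quotient lift to `A` up to
the fixed error `u` (`ArchQuotient.le_add_of_mk_le`). A family `n|x| ≤ |y|` thus lifts to `n|a| ≤
|b| + u`, with a bound independent of `n`.

Incompleteness. The partial sums of `∑ 2⁻ⁱ ◇ⁱ 1` are Cauchy relative to `1`. In the model
`Countdown`, `◇ⁱ 1` is the indicator of `{n | i ≤ n}`, so a limit would be sent to the strictly
increasing function `n ↦ ∑_{i ≤ n} 2⁻ⁱ`. But each formula denotes an eventually constant function
there, since it can look only finitely many steps ahead. -/

theorem le_of_nsmul_le_nsmul {A : Type*} [AddCommGroup A] [Lattice A] [Module ℝ A]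
    [PosSMulMono ℝ A] {n : ℕ} (hn : n ≠ 0) {a b : A} (h : n • a ≤ n • b) : a ≤ b := by
  have hn' : (n : ℝ) ≠ 0 := Nat.cast_ne_zero.mpr hn
  have h' := smul_le_smul_of_nonneg_left h (inv_nonneg.mpr (Nat.cast_nonneg (α := ℝ) n))
  simpa only [← Nat.cast_smul_eq_nsmul ℝ, smul_smul, inv_mul_cancel₀ hn', one_smul] using h'

variable {A : Type*} [AddCommGroup A] [Lattice A] [IsOrderedAddMonoid A]

theorem abs_sup_le_add (a b : A) : |a ⊔ b| ≤ |a| + |b| := by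
  refine sup_le (sup_le ?_ ?_) ?_
  · exact (le_abs_self a).trans (le_add_of_nonneg_right (abs_nonneg b))
  · exact (le_abs_self b).trans (le_add_of_nonneg_left (abs_nonneg a))
  · rw [neg_sup]
    exact inf_le_left.trans ((neg_le_abs a).trans (le_add_of_nonneg_right (abs_nonneg b)))

theorem abs_inf_le_add (a b : A) : |a ⊓ b| ≤ |a| + |b| := by
  have h := abs_sup_le_add (-a) (-b)
  rwa [← neg_inf, abs_neg, abs_neg, abs_neg] at h

variable [Module ℝ A] [PosSMulMono ℝ A]

theorem smul_le_smul_right_of_nonneg {r s : ℝ} (h : r ≤ s) {a : A} (ha : 0 ≤ a) :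
    r • a ≤ s • a := by
  rw [← sub_nonneg, ← sub_smul]
  exact smul_nonneg (sub_nonneg.mpr h) ha

theorem InfinitelySmall.abs_le_of_isStrongUnit {u a : A} (hu : IsStrongUnit u)
    (ha : InfinitelySmall a) : |a| ≤ u := by
  obtain ⟨b, hb⟩ := ha
  obtain ⟨m, hm⟩ := hu.2 b
  -- `m` may be `0`, so the division is by `m + 1`.
  refine le_of_nsmul_le_nsmul m.succ_ne_zero ((hb (m + 1)).trans (hm.trans ?_))
  exact nsmul_le_nsmul_left hu.1 m.le_succ

theorem ArchQuotient.mk_abs (a : A) : mk |a| = |mk a| := rfl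

theorem ArchQuotient.mk_nsmul (n : ℕ) (a : A) : mk (n • a) = n • mk a :=
  map_nsmul (infinitesimals A).mkQ n a

/-- The hypothesis says that `a ⊓ b` and `a` differ by an infinitely small element, hence by at most
`u`. The error does not depend on `a` and `b`. -/
theorem ArchQuotient.le_add_of_mk_le {u : A} (hu : IsStrongUnit u) {a b : A}
    (h : mk a ≤ mk b) : a ≤ b + u := by
  rw [le_def, ← mk_inf, mk_eq] at h
  have h' := (neg_le_abs _).trans (h.abs_le_of_isStrongUnit hu)
  rw [neg_sub, sub_le_iff_le_add'] at h'
  exact h'.trans (add_le_add_left inf_le_right u)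

theorem IsStrongUnit.archQuotient {u : A} (hu : IsStrongUnit u) :
    IsStrongUnit (ArchQuotient.mk u) := by
  refine ⟨ArchQuotient.mk_le_mk hu.1, fun x => ?_⟩
  induction x using ArchQuotient.ind with | _ a
  obtain ⟨n, hn⟩ := hu.2 a
  refine ⟨n, ?_⟩
  rw [← ArchQuotient.mk_abs, ← ArchQuotient.mk_nsmul]
  exact ArchQuotient.mk_le_mk hn

theorem IsStrongUnit.isArchimedean_archQuotient {u : A} (hu : IsStrongUnit u) :
    IsArchimedean (ArchQuotient A) := by
  intro x
  induction x using ArchQuotient.ind with | _ a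
  rintro ⟨y, hy⟩
  induction y using ArchQuotient.ind with | _ b
  suffices h : InfinitelySmall (a - 0) from ArchQuotient.mk_eq.mpr h
  rw [sub_zero]
  -- Each inequality `n|mk a| ≤ |mk b|` lifts with its own infinitely small error; `u` absorbs all
  -- of them at once.
  refine ⟨|b| + u, fun n => ?_⟩
  rw [abs_of_nonneg (add_nonneg (abs_nonneg b) hu.1)]
  refine ArchQuotient.le_add_of_mk_le hu ?_
  rw [ArchQuotient.mk_nsmul, ArchQuotient.mk_abs, ArchQuotient.mk_abs]
  exact hy n

end General

/-! ### The term algebra is unital -/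

namespace TermAlg

theorem mk_one : mk .one = unit := rfl

theorem isStrongUnit_unit : IsStrongUnit (unit : TermAlg) := by
  have hu : (0 : TermAlg) ≤ unit := unit_nonneg
  refine ⟨hu, fun x => ?_⟩
  induction x using ind with | _ φ
  -- Sums, joins and meets are all bounded in absolute value by `|a| + |b|`, so one argument serves
  -- the three cases.
  have join {a b c : TermAlg} (hc : |c| ≤ |a| + |b|) (ha : ∃ n : ℕ, |a| ≤ n • unit)
      (hb : ∃ n : ℕ, |b| ≤ n • unit) : ∃ n : ℕ, |c| ≤ n • (unit : TermAlg) := by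
    obtain ⟨m, hm⟩ := ha
    obtain ⟨n, hn⟩ := hb
    exact ⟨m + n, hc.trans ((add_le_add hm hn).trans_eq (add_nsmul _ _ _).symm)⟩
  induction φ with
  | zero => exact ⟨0, by rw [mk_zero, abs_zero, zero_nsmul]⟩
  | one => exact ⟨1, by rw [mk_one, abs_of_nonneg hu, one_nsmul]⟩
  | smul r φ ih =>
    obtain ⟨n, hn⟩ := ih
    obtain ⟨m, hm⟩ := exists_nat_ge |r|
    refine ⟨m * n, ?_⟩
    rw [mk_smul]
    calc |r • mk φ| ≤ |r| • |mk φ| := abs_smul_le _ _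
      _ ≤ (m : ℝ) • |mk φ| := smul_le_smul_right_of_nonneg hm (abs_nonneg _)
      _ = m • |mk φ| := Nat.cast_smul_eq_nsmul _ _ _
      _ ≤ m • n • unit := nsmul_le_nsmul_right hn m
      _ = (m * n) • unit := (mul_nsmul' _ _ _).symm
  | add φ ψ ihφ ihψ => exact join (abs_add_le (mk φ) (mk ψ)) ihφ ihψ
  | sup φ ψ ihφ ihψ => exact join (abs_sup_le_add (mk φ) (mk ψ)) ihφ ihψ
  | inf φ ψ ihφ ihψ => exact join (abs_inf_le_add (mk φ) (mk ψ)) ihφ ihψ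
  | dia φ ih =>
    obtain ⟨n, hn⟩ := ih
    refine ⟨n, ?_⟩
    calc |mk (.dia φ)| ≤ ModalStructure.dia |mk φ| := abs_dia_le (mk φ)
      _ ≤ ModalStructure.dia (n • unit) := dia_mono hn
      _ = n • ModalStructure.dia unit := map_nsmul _ _ _
      _ ≤ n • unit := nsmul_le_nsmul_right dia_unit_le n

end TermAlg

/-! ### Interpretation of formulas in a modal Riesz space -/

section Interpretation

variable {A : Type*} [AddCommGroup A] [Module ℝ A] [Lattice A] [ModalStructure A]

variable (A) in
/-- The value of a formula in a modal Riesz space. -/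
def Form.eval : Form → A
  | .zero => 0
  | .one => unit
  | .smul r φ => r • φ.eval
  | .add φ ψ => φ.eval + ψ.eval
  | .sup φ ψ => φ.eval ⊔ ψ.eval
  | .inf φ ψ => φ.eval ⊓ ψ.eval
  | .dia φ => ModalStructure.dia φ.eval

theorem ModalHom.ext_toFun {B : Type*} [AddCommGroup B] [Module ℝ B] [Lattice B]
    [ModalStructure B] {f g : ModalHom A B} (h : ∀ a, f.toFun a = g.toFun a) : f = g := by
  obtain ⟨f, _⟩ := f
  obtain ⟨g, _⟩ := g
  obtain rfl : f = g := LinearMap.ext h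
  rfl

theorem ModalHom.map_abs {B : Type*} [AddCommGroup B] [Module ℝ B] [Lattice B]
    [ModalStructure B] (f : ModalHom A B) (a : A) : f.toFun |a| = |f.toFun a| :=
  (f.map_sup' a (-a)).trans (congrArg (f.toFun a ⊔ ·) (map_neg f.toLinearMap a))

theorem ModalHom.monotone {B : Type*} [AddCommGroup B] [Module ℝ B] [Lattice B]
    [ModalStructure B] (f : ModalHom A B) {a b : A} (h : a ≤ b) : f.toFun a ≤ f.toFun b := by
  rw [← inf_eq_left, ← f.map_inf', inf_eq_left.mpr h]

/-- This is why homomorphisms into Archimedean spaces vanish on `infinitesimals`. -/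
theorem InfinitelySmall.map {B : Type*} [AddCommGroup B] [Module ℝ B] [Lattice B]
    [ModalStructure B] (f : ModalHom A B) {a : A} (h : InfinitelySmall a) :
    InfinitelySmall (f.toFun a) := by
  obtain ⟨b, hb⟩ := h
  refine ⟨f.toFun b, fun n => ?_⟩
  rw [← f.map_abs, ← f.map_abs]
  exact (map_nsmul f.toLinearMap n |a|).symm.trans_le (f.monotone (hb n))

variable [IsOrderedAddMonoid A] [PosSMulMono ℝ A]

/-- Soundness of the calculus, needed for `TermAlg.eval` to be well defined. -/
theorem Provable.eval_eq {φ ψ : Form} (h : Provable φ ψ) : φ.eval A = ψ.eval A := by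
  induction h with
  | refl => rfl
  | symm _ ih => exact ih.symm
  | trans _ _ ih ih' => exact ih.trans ih'
  | congr_smul r _ ih => exact congrArg (r • ·) ih
  | congr_add _ _ ih ih' => exact congrArg₂ (· + ·) ih ih'
  | congr_sup _ _ ih ih' => exact congrArg₂ (· ⊔ ·) ih ih'
  | congr_inf _ _ ih ih' => exact congrArg₂ (· ⊓ ·) ih ih'
  | congr_dia _ ih => exact congrArg ModalStructure.dia ih
  | add_assoc => exact (_root_.add_assoc _ _ _).symm
  | add_comm => exact _root_.add_comm _ _
  | add_zero => exact _root_.add_zero _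
  | add_neg => simp [Form.eval]
  | smul_smul => exact _root_.smul_smul _ _ _
  | one_smul => exact _root_.one_smul _ _
  | smul_add => exact _root_.smul_add _ _ _
  | add_smul => exact _root_.add_smul _ _ _
  | sup_assoc => exact (_root_.sup_assoc _ _ _).symm
  | inf_assoc => exact (_root_.inf_assoc _ _ _).symm
  | sup_comm => exact _root_.sup_comm _ _
  | inf_comm => exact _root_.inf_comm _ _
  | sup_inf_self => exact _root_.sup_inf_self
  | inf_sup_self => exact _root_.inf_sup_self
  | sup_idem => exact _root_.sup_idem _
  | inf_idem => exact _root_.inf_idem _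
  | add_compat => exact inf_eq_left.mpr (add_le_add_left inf_le_right _)
  | smul_compat r _ _ hr => exact inf_eq_left.mpr (smul_le_smul_of_nonneg_left inf_le_right hr)
  | one_nonneg => exact inf_eq_left.mpr unit_nonneg
  | dia_linear => simp [Form.eval]
  | dia_nonneg => exact inf_eq_left.mpr (ModalStructure.dia_nonneg _)
  | dia_one_le => exact inf_eq_left.mpr dia_unit_le

variable (A) in
/-- The homomorphism from the term algebra to a modal Riesz space given by evaluation. -/
def TermAlg.eval : ModalHom TermAlg A where
  toFun := Quotient.lift (Form.eval A) fun _ _ h => h.eval_eq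
  map_add' x y := by
    induction x using ind
    induction y using ind
    rfl
  map_smul' r x := by
    induction x using ind
    rfl
  map_sup' x y := by
    induction x using ind
    induction y using ind
    rfl
  map_inf' x y := by
    induction x using ind
    induction y using ind
    rfl
  map_unit' := rfl
  map_dia' x := by
    induction x using ind
    rfl


/-- A homomorphism to an Archimedean modal Riesz space factors through the quotient by the
infinitely small elements. -/
def ModalHom.archLift {B : Type*} [AddCommGroup B] [Module ℝ B] [Lattice B]
    [ModalStructure B] (hB : IsArchimedean B) (f : ModalHom A B) : ModalHom (ArchQuotient A) B where
  toLinearMap := (infinitesimals A).liftQ f.toLinearMap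
    fun _ h => LinearMap.mem_ker.mpr (hB _ (InfinitelySmall.map f h))
  map_sup' x y := by
    induction x using ArchQuotient.ind
    induction y using ArchQuotient.ind
    exact f.map_sup' _ _
  map_inf' x y := by
    induction x using ArchQuotient.ind
    induction y using ArchQuotient.ind
    exact f.map_inf' _ _
  map_unit' := f.map_unit'
  map_dia' x := by
    induction x using ArchQuotient.ind
    exact f.map_dia' _

/-- The right-hand side does not mention `f`, and classes of formulas exhaust `𝕀_a`; hence any two
homomorphisms agree. -/
theorem ModalHom.initialArch_apply {B : Type*} [AddCommGroup B] [Module ℝ B] [Lattice B]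
    [ModalStructure B] (f : ModalHom InitialArch B) (φ : Form) :
    f.toFun (ArchQuotient.mk (TermAlg.mk φ)) = φ.eval B := by
  induction φ with
  | zero => exact map_zero f.toLinearMap
  | one => exact f.map_unit'
  | smul r φ ih => exact (f.map_smul' r _).trans (congrArg (r • ·) ih)
  | add φ ψ ihφ ihψ => exact (f.map_add' _ _).trans (congrArg₂ (· + ·) ihφ ihψ)
  | sup φ ψ ihφ ihψ => exact (f.map_sup' _ _).trans (congrArg₂ (· ⊔ ·) ihφ ihψ)
  | inf φ ψ ihφ ihψ => exact (f.map_inf' _ _).trans (congrArg₂ (· ⊓ ·) ihφ ihψ)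
  | dia φ ih => exact (f.map_dia' _).trans (congrArg ModalStructure.dia ih)

variable (A) in
/-- The homomorphism from `𝕀_a` to an Archimedean modal Riesz space is unique. -/
theorem nonempty_unique_initialArch_hom (hA : IsArchimedean A) :
    Nonempty (Unique (ModalHom InitialArch A)) := by
  refine ⟨⟨⟨(TermAlg.eval A).archLift hA⟩, fun f => ModalHom.ext_toFun fun x => ?_⟩⟩
  induction x using ArchQuotient.ind with | _ t
  induction t using TermAlg.ind with | _ φ
  rw [ModalHom.initialArch_apply, ModalHom.initialArch_apply]

end Interpretation

/-! ### Failure of uniform completeness -/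

section GeometricSum

variable {A : Type*} [AddCommGroup A] [Module ℝ A] [Lattice A] [ModalStructure A]

variable (A) in
/-- The partial sums of `∑ 2⁻ⁱ ◇ⁱ 1`. -/
noncomputable def geomSum (n : ℕ) : A :=
  ∑ i ∈ Finset.range n, ((1 / 2 : ℝ) ^ i) • (ModalStructure.dia^[i] (unit : A))

theorem geomSum_succ (n : ℕ) :
    geomSum A (n + 1) = geomSum A n + ((1 / 2 : ℝ) ^ n) • (ModalStructure.dia^[n] (unit : A)) :=
  Finset.sum_range_succ _ _

theorem ModalHom.map_iterate_dia_unit {B : Type*} [AddCommGroup B] [Module ℝ B] [Lattice B]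
    [ModalStructure B] (f : ModalHom A B) (n : ℕ) :
    f.toFun (ModalStructure.dia^[n] unit) = ModalStructure.dia^[n] unit := by
  induction n with
  | zero => exact f.map_unit'
  | succ n ih => rw [Function.iterate_succ_apply', f.map_dia', ih, Function.iterate_succ_apply']

theorem ModalHom.map_geomSum {B : Type*} [AddCommGroup B] [Module ℝ B] [Lattice B]
    [ModalStructure B] (f : ModalHom A B) (n : ℕ) : f.toFun (geomSum A n) = geomSum B n := by
  refine (map_sum f.toLinearMap _ _).trans (Finset.sum_congr rfl fun i _ => ?_)
  exact (f.map_smul' _ _).trans (congrArg _ (f.map_iterate_dia_unit i))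

variable [IsOrderedAddMonoid A]

theorem iterate_dia_unit_nonneg (n : ℕ) : 0 ≤ ModalStructure.dia^[n] (unit : A) := by
  induction n with
  | zero => exact unit_nonneg
  | succ n ih =>
    rw [Function.iterate_succ_apply']
    exact (map_zero (ModalStructure.dia : A →ₗ[ℝ] A)).symm.trans_le (dia_mono ih)

theorem iterate_dia_unit_le (n : ℕ) : ModalStructure.dia^[n] (unit : A) ≤ unit := by
  induction n with
  | zero => exact le_rfl
  | succ n ih =>
    rw [Function.iterate_succ_apply']
    exact (dia_mono ih).trans dia_unit_le

variable [PosSMulMono ℝ A]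

variable (A) in
theorem geomSum_monotone : Monotone (geomSum A) :=
  monotone_nat_of_le_succ fun n => by
    rw [geomSum_succ]
    exact le_add_of_nonneg_right (smul_nonneg (by positivity) (iterate_dia_unit_nonneg n))

variable (A) in
-- As `◇ⁱ 1 ≤ 1`, the tail from `n` on is at most `∑_{i ≥ n} 2⁻ⁱ = 2 · 2⁻ⁿ`. Adding this bound to
-- the partial sums gives decreasing upper bounds for all later sums.
theorem geomSum_add_antitone :
    Antitone fun n => geomSum A n + (2 * (1 / 2 : ℝ) ^ n) • (unit : A) :=
  antitone_nat_of_succ_le fun n => by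
    have h : (2 * (1 / 2 : ℝ) ^ n) • (unit : A)
        = ((1 / 2 : ℝ) ^ n) • unit + (2 * (1 / 2 : ℝ) ^ (n + 1)) • unit := by
      rw [← add_smul]
      congr 1
      ring
    rw [geomSum_succ, h, add_assoc]
    gcongr
    exact iterate_dia_unit_le n

theorem geomSum_le {m n : ℕ} (h : m ≤ n) :
    geomSum A n ≤ geomSum A m + (2 * (1 / 2 : ℝ) ^ m) • unit :=
  (le_add_of_nonneg_right (smul_nonneg (by positivity) unit_nonneg)).trans
    (geomSum_add_antitone A h)

variable (A) in
theorem isUniformCauchy_geomSum : IsUniformCauchy (unit : A) (geomSum A) := by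
  intro ε hε
  -- This makes the tail bound `2 · 2⁻ᴺ` smaller than `ε`.
  obtain ⟨N, hN⟩ := exists_pow_lt_of_lt_one (half_pos hε) (by norm_num : (1 / 2 : ℝ) < 1)
  have key {i j : ℕ} (hi : N < i) (hj : N < j) : geomSum A i - geomSum A j ≤ ε • unit := by
    rw [sub_le_iff_le_add']
    refine (geomSum_le hi.le).trans (add_le_add (geomSum_monotone A hj.le) ?_)
    exact smul_le_smul_right_of_nonneg (by linarith) unit_nonneg
  refine ⟨N, fun i j hi hj => sup_le (key hi hj) ?_⟩
  rw [neg_sub]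
  exact key hj hi

end GeometricSum

/-! ### A model in which the geometric series has no definable limit. -/

/-- Real functions on the Markov chain on `ℕ` that steps from `n + 1` to `n` and halts at `0`. -/
abbrev Countdown : Type := ℕ → ℝ

namespace Countdown

instance : ModalStructure Countdown where
  unit := 1
  unit_nonneg := zero_le_one
  dia :=
    -- `◇f` is the expected value of `f` after one step. The value `0` at the halting state makes
    -- `◇1` differ from `1`, and so lets formulas tell states apart.
    { toFun := fun f n => Nat.casesOn n 0 f
      map_add' := fun f g => by ext (_ | n) <;> simp
      map_smul' := fun r f => by ext (_ | n) <;> simp }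
  dia_nonneg := by
    rintro f (_ | n)
    · exact le_rfl
    · exact le_sup_right
  dia_unit_le := by
    rintro (_ | n)
    · exact zero_le_one
    · exact le_rfl

theorem unit_apply (n : ℕ) : (unit : Countdown) n = 1 := rfl
theorem dia_apply_succ (f : Countdown) (n : ℕ) : ModalStructure.dia f (n + 1) = f n := rfl

theorem isArchimedean : IsArchimedean Countdown := by
  rintro f ⟨g, h⟩
  ext n
  by_contra hne
  obtain ⟨k, hk⟩ := Archimedean.arch (|g n| + 1) (abs_pos.mpr hne)
  have hkn : k • |f n| ≤ |g n| := h k n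
  linarith

/-- Pointwise operations preserve eventual constancy, and `◇` shifts a function by one place, which
only raises the threshold by one. -/
theorem eval_eventually_const (φ : Form) : ∃ N, ∀ n, N ≤ n → φ.eval Countdown n =
    φ.eval Countdown N := by
  suffices h : ∃ N c, ∀ n, N ≤ n → φ.eval Countdown n = c by
    obtain ⟨N, c, hc⟩ := h
    exact ⟨N, fun n hn => (hc n hn).trans (hc N le_rfl).symm⟩
  have join {φ ψ χ : Form} (op : ℝ → ℝ → ℝ)
      (hop : ∀ n, χ.eval Countdown n = op (φ.eval Countdown n) (ψ.eval Countdown n))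
      (hφ : ∃ N c, ∀ n, N ≤ n → φ.eval Countdown n = c)
      (hψ : ∃ N c, ∀ n, N ≤ n → ψ.eval Countdown n = c) :
      ∃ N c, ∀ n, N ≤ n → χ.eval Countdown n = c := by
    obtain ⟨M, c, hc⟩ := hφ
    obtain ⟨N, d, hd⟩ := hψ
    refine ⟨max M N, op c d, fun n hn => ?_⟩
    rw [hop, hc n (le_of_max_le_left hn), hd n (le_of_max_le_right hn)]
  induction φ with
  | zero => exact ⟨0, 0, fun _ _ => rfl⟩
  | one => exact ⟨0, 1, fun _ _ => rfl⟩
  | smul r φ ih => exact join (fun a _ => r * a) (fun _ => rfl) ih ih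
  | add φ ψ ihφ ihψ => exact join (· + ·) (fun _ => rfl) ihφ ihψ
  | sup φ ψ ihφ ihψ => exact join (· ⊔ ·) (fun _ => rfl) ihφ ihψ
  | inf φ ψ ihφ ihψ => exact join (· ⊓ ·) (fun _ => rfl) ihφ ihψ
  | dia φ ih =>
    obtain ⟨N, c, hc⟩ := ih
    refine ⟨N + 1, c, fun n hn => ?_⟩
    obtain ⟨n, rfl⟩ := Nat.exists_eq_add_of_le' (Nat.le_of_add_left_le hn)
    exact hc n (by omega)

/-- `◇ⁱ 1` at `n` is the probability that the chain started at `n` makes `i` steps. -/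
theorem iterate_dia_unit_apply (i n : ℕ) :
    (ModalStructure.dia^[i] (unit : Countdown)) n = if i ≤ n then 1 else 0 := by
  induction i generalizing n with
  | zero => rfl
  | succ i ih =>
    rw [Function.iterate_succ_apply']
    cases n with
    | zero => rfl
    | succ n => rw [dia_apply_succ, ih]; simp

theorem geomSum_apply (m n : ℕ) : geomSum Countdown m n =
    ∑ i ∈ Finset.range m, (1 / 2 : ℝ) ^ i * if i ≤ n then 1 else 0 := by
  simp only [geomSum, Finset.sum_apply, Pi.smul_apply, iterate_dia_unit_apply, smul_eq_mul]

/-- Only the indicator with `i = n + 1` separates `n` from `n + 1`. The jump is independent of `m`,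
so it persists in a uniform limit. -/
theorem geomSum_apply_succ_sub {m n : ℕ} (h : n + 1 < m) :
    geomSum Countdown m (n + 1) - geomSum Countdown m n = (1 / 2 : ℝ) ^ (n + 1) := by
  rw [geomSum_apply, geomSum_apply, ← Finset.sum_sub_distrib,
    Finset.sum_eq_single_of_mem (n + 1) (Finset.mem_range.mpr h)]
  · simp
  · intro i _ hi
    have : i ≤ n + 1 ↔ i ≤ n := by omega
    simp [this]

end Countdown

theorem not_isUniformlyComplete_initialArch : ¬ IsUniformlyComplete InitialArch := by
  intro hcomp
  obtain ⟨b, hb⟩ := hcomp unit unit_nonneg _ (isUniformCauchy_geomSum InitialArch)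
  -- `Countdown` contains unbounded functions, so it is not unital; being Archimedean is enough for
  -- the factorization.
  let f : ModalHom InitialArch Countdown :=
    (TermAlg.eval Countdown).archLift Countdown.isArchimedean
  have hlim (ε : ℝ) (hε : 0 < ε) :
      ∃ N : ℕ, ∀ m, N < m → ∀ k, |f.toFun b k - geomSum Countdown m k| ≤ ε := by
    obtain ⟨N, hN⟩ := hb ε hε
    refine ⟨N, fun m hm k => ?_⟩
    have h := f.monotone (hN m hm)
    rw [f.map_abs] at h
    have hs : f.toFun (b - geomSum InitialArch m) = f.toFun b - geomSum Countdown m :=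
      (map_sub f.toLinearMap _ _).trans (congrArg (f.toFun b - ·) (f.map_geomSum m))
    have hu : f.toFun (ε • unit) = ε • unit :=
      (f.map_smul' _ _).trans (congrArg (ε • ·) f.map_unit')
    rw [hs, hu] at h
    simpa [Countdown.unit_apply] using h k
  obtain ⟨K, hK⟩ : ∃ K, ∀ n, K ≤ n → f.toFun b n = f.toFun b K := by
    induction b using ArchQuotient.ind with | _ t
    induction t using TermAlg.ind with | _ φ
    rw [f.initialArch_apply]
    exact Countdown.eval_eventually_const φ
  have hpos : (0 : ℝ) < (1 / 2) ^ (K + 1) := by positivity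
  -- Past `K` the image of `b` is constant, while the partial sums jump by `2⁻⁽ᴷ⁺¹⁾` between `K` and
  -- `K + 1`. Errors of a quarter of the jump at both points account for at most half of it.
  obtain ⟨N, hN⟩ := hlim ((1 / 2) ^ (K + 1) / 4) (by positivity)
  -- The index `N + K + 2` exceeds both `N`, for the approximation, and `K + 1`, so that the sum
  -- contains the jumping term.
  have h0 := abs_le.mp (hN (N + K + 2) (by omega) K)
  have h1 := abs_le.mp (hN (N + K + 2) (by omega) (K + 1))
  have h2 := Countdown.geomSum_apply_succ_sub (m := N + K + 2) (n := K) (by omega)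
  rw [hK (K + 1) K.le_succ] at h1
  linarith [h0.1, h0.2, h1.1, h1.2]

end RieszModal

/-- `𝕀_a` is Archimedean and unital, it is initial among Archimedean unital modal Riesz spaces, and
it is not uniformly complete. -/
theorem theorem5p12 :
    (RieszModal.IsArchimedean RieszModal.InitialArch ∧
      RieszModal.IsStrongUnit (RieszModal.ModalStructure.unit : RieszModal.InitialArch) ∧
      ∀ (A : Type*) [AddCommGroup A] [Module ℝ A] [Lattice A] [IsOrderedAddMonoid A]
        [PosSMulMono ℝ A] [RieszModal.ModalStructure A],
        RieszModal.IsArchimedean A →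
        RieszModal.IsStrongUnit (RieszModal.ModalStructure.unit : A) →
        Nonempty (Unique (RieszModal.ModalHom RieszModal.InitialArch A))) ∧
    ¬ RieszModal.IsUniformlyComplete RieszModal.InitialArch :=
  ⟨⟨RieszModal.TermAlg.isStrongUnit_unit.isArchimedean_archQuotient,
    RieszModal.TermAlg.isStrongUnit_unit.archQuotient,
    fun A _ _ _ _ _ _ hA _ => RieszModal.nonempty_unique_initialArch_hom A hA⟩,
    RieszModal.not_isUniformlyComplete_initialArch⟩
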